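/- Let $\mathcal X$ be a finite set with $|\mathcal X|=N$, and let $\Delta_{\mathcal X}$ be the set of probability distributions on $\mathcal X$. For $p,q\in\Delta_{\mathcal X}$, say that $q$ is calibrated with respect to $p$ if for all $t\in[0,1]$ the level set $B_t=\{x: q_x=t\}$ satisfies $\sum_{x\in B_t}q_x=\sum_{x\in B_t}p_x$. For a function $f$ and a distribution $r$, let $\ell(q,x)=f(1/q_x)$ and $\ell(q;r)=\sum_x r_x\,\ell(q,x)$. A function $f:[1,\infty)\to\mathbb R$ is called $b(z)$-left-strongly concave if for every $z\ge 1$ the restriction of $f$ to $[1,z]$ is $b(z)$-strongly concave, i.e. $f(\lambda y+(1-\lambda)y')\ge\lambda f(y)+(1-\lambda)f(y')+\frac{b(z)}{2}\lambda(1-\lambda)(y-y')^2$ for all $y,y'\in[1,z]$ and $\lambda\in[0,1]$ (for differentiable $f$: $f(y)\le f(y')+f'(y')(y-y')-\frac{b(z)}{2}(y-y')^2$). **Theorem (Sample properness).** There is an absolute constant $c_1>0$ with the following property. Let $f:[1,\infty)\to\mathbb R$ be nonnegative, nondecreasing and concave, with $f(z)\le c\sqrt z$ for all $z\ge1$ and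 some constant $c$, and let $f$ be $\frac{C(z)}{z^2}$-left-strongly concave for some nonnegative nonincreasing $C:[1,\infty)\to\mathbb R$. Let $p,q\in\Delta_{\mathcal X}$ be such that $q$ is calibrated with respect to $p$ and $p\ne q$, write $\epsilon=\|p-q\|_1=\sum_x|p_x-q_x|$, and suppose that $C(4N/\epsilon)>0$. Let $\delta\in(0,1)$ and $$\beta=\frac{288\,N^8}{\delta\cdot\min\left(1,\left[C\!\left(\tfrac{4N}{\epsilon}\right)\frac{\epsilon^2}{128\,c}\right]^2\right)}.$$ If $m\le N$ and $$m\ \ge\ \frac{c_1\, f(\beta)^2\,\ln\frac1\delta}{\left(C\!\left(\tfrac{4N}{\epsilon}\right)\epsilon^2\right)^2},$$ and $\hat p$ is the empirical distribution of $m$ independent samples from $p$, then with probability at least $1-\delta$ $$\ell(q;\hat p)>\ell(p;\hat p).$$ -/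

import Mathlib

open MeasureTheory ProbabilityTheory Set

noncomputable section

/-- The local loss generated by `f`: outcome `x` costs the candidate `q` the amount `f (1 / q x)`. -/
def localLoss {X : Type*} (f : ℝ → ℝ) (q : X → ℝ) (x : X) : ℝ :=
  f (1 / q x)

/-- The expected loss `ℓ(q; p)`, the mean of `ℓ(q, x)` for `x` drawn from `p`. -/
def expectedLoss {X : Type*} [Fintype X] (l : (X → ℝ) → X → ℝ) (q p : X → ℝ) : ℝ :=
  ∑ x, p x * l q x

/-- The `ℓ¹` distance `‖p - q‖₁`. -/
def l1Dist {X : Type*} [Fintype X] (p q : X → ℝ) : ℝ :=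
  ∑ x, |p x - q x|

open Classical in
/-- `q` is calibrated with respect to `p`: for every `t ∈ [0, 1]`, both give the same mass to the
level set `{x | q x = t}`. -/
def IsCalibrated {X : Type*} [Fintype X] (q p : X → ℝ) : Prop :=
  ∀ t ∈ Icc (0 : ℝ) 1,
    ∑ x ∈ Finset.univ.filter (fun x => q x = t), q x =
      ∑ x ∈ Finset.univ.filter (fun x => q x = t), p x

open Classical in
/-- The empirical distribution of the sample `s 0, …, s (m - 1)`. -/
def empiricalDist {X : Type*} {m : ℕ} (s : Fin m → X) (x : X) : ℝ :=
  ((Finset.univ.filter (fun i => s i = x)).card : ℝ) / m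

/-- `f` is `b(z)`-left-strongly concave on the domain `D`: for each `z ∈ D`, the restriction of `f`
to the part of `D` at or below `z` is `b z`-strongly concave. For differentiable `f` this is the
inequality `f y ≤ f y' + f' y' * (y - y') - b z / 2 * (y - y') ^ 2` for `y, y' ≤ z` in `D`. -/
def LeftStronglyConcaveOn (D : Set ℝ) (b f : ℝ → ℝ) : Prop :=
  ∀ z ∈ D, StrongConcaveOn (D ∩ Iic z) (b z) f

/-- The number `β = 288 N⁸ / (δ · min (1, [C(4N/ε) · ε² / (128 c)]²))`. -/
def sampleBeta (C : ℝ → ℝ) (c : ℝ) (N : ℕ) (ε δ : ℝ) : ℝ :=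
  288 * (N : ℝ) ^ 8 / (δ * min 1 ((C (4 * N / ε) * (ε ^ 2 / (128 * c))) ^ 2))

end

/-! ### Consequences of calibration. -/

section Calibration

variable {X : Type*} [Fintype X] {p q : X → ℝ}

/-! With `Y x = f (1 / q x) - f (1 / p x)`, the claim is that the sample sum of `Y` is positive, so
it is enough that `Y` has a sizeable mean and is essentially bounded. Mean: a supergradient of `f`
at `1 / q x` bounds `p x * Y x` below by a multiple of `p x - q x` whose coefficient depends only on
`q x`. Calibration makes these terms sum to zero, and strong concavity leaves a quadratic remainder
of order `ε ^ 2` (`strong_properness`). Boundedness: where `p` and `q` are at least `1 / β`, `|Y|`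
is at most `f β`. The other outcomes are rarely sampled, and `f z ≤ c * √z` limits their share of
the mean (`sum_ite_loss_le`). A Chernoff bound on samples avoiding the rare outcomes concludes
(`chernoff_restricted`, `sum_mul_exp_le`). -/

theorem le_one_of_mem_stdSimplex (hq : q ∈ stdSimplex ℝ X) (x : X) : q x ≤ 1 :=
  hq.2 ▸ Finset.single_le_sum (fun y _ => hq.1 y) (Finset.mem_univ x)

/-- Calibration lets one replace `p` by `q` when averaging functions of `q`. -/
theorem IsCalibrated.sum_mul_comp_eq (h : IsCalibrated q p) (hq : q ∈ stdSimplex ℝ X)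
    (φ : ℝ → ℝ) : ∑ x, p x * φ (q x) = ∑ x, q x * φ (q x) := by
  classical
  have key (r : X → ℝ) : ∑ x, r x * φ (q x) =
      ∑ t ∈ Finset.univ.image q, (∑ x ∈ Finset.univ.filter (fun x => q x = t), r x) * φ t := by
    rw [← Finset.sum_fiberwise_of_maps_to
      (fun x _ => Finset.mem_image_of_mem q (Finset.mem_univ x))]
    refine Finset.sum_congr rfl fun t _ => ?_
    rw [Finset.sum_mul]
    refine Finset.sum_congr rfl fun x hx => ?_
    rw [(Finset.mem_filter.1 hx).2]
  rw [key, key]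
  refine Finset.sum_congr rfl fun t ht => ?_
  obtain ⟨x, -, rfl⟩ := Finset.mem_image.1 ht
  have := h (q x) ⟨hq.1 x, le_one_of_mem_stdSimplex hq x⟩
  congr 1
  convert this.symm using 2

theorem IsCalibrated.eq_zero (h : IsCalibrated q p) (hp : p ∈ stdSimplex ℝ X)
    (hq : q ∈ stdSimplex ℝ X) {x : X} (hx : q x = 0) : p x = 0 := by
  classical
  have h0 : ∑ y, p y * (if q y = 0 then 1 else 0) = 0 := by
    rw [h.sum_mul_comp_eq hq (fun t => if t = 0 then 1 else 0)]
    exact Finset.sum_eq_zero fun y _ => by split_ifs with hy <;> simp [hy]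
  have := (Finset.sum_eq_zero_iff_of_nonneg
    (fun y _ => mul_nonneg (hp.1 y) (by split_ifs <;> norm_num))).1 h0 x (Finset.mem_univ x)
  simpa [hx] using this

/-- A value 1 would make `q` a point mass, and calibration at level 0 would then force `p = q`.
Strictness puts `1 / q x` in the interior of the domain of `f`. -/
theorem IsCalibrated.lt_one (h : IsCalibrated q p) (hp : p ∈ stdSimplex ℝ X)
    (hq : q ∈ stdSimplex ℝ X) (hne : p ≠ q) (x : X) : q x < 1 := by
  classical
  refine lt_of_le_of_ne (le_one_of_mem_stdSimplex hq x) fun hx => hne ?_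
  have hq0 (y : X) (hy : y ≠ x) : q y = 0 := by
    have h1 := Finset.sum_erase_eq_sub (f := q) (Finset.mem_univ x)
    rw [hq.2, hx, sub_self] at h1
    exact (Finset.sum_eq_zero_iff_of_nonneg (fun z _ => hq.1 z)).1 h1 y (by simp [hy])
  have hp0 (y : X) (hy : y ≠ x) : p y = 0 := h.eq_zero hp hq (hq0 y hy)
  have hpx : p x = 1 := by
    rw [← hp.2, Finset.sum_eq_single x (fun y _ hy => hp0 y hy) (by simp)]
  ext y
  by_cases hy : y = x
  · rw [hy, hpx, hx]
  · rw [hq0 y hy, hp0 y hy]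

theorem l1Dist_pos (hne : p ≠ q) : 0 < l1Dist p q := by
  obtain ⟨x, hx⟩ := Function.ne_iff.1 hne
  exact Finset.sum_pos' (fun _ _ => abs_nonneg _)
    ⟨x, Finset.mem_univ x, abs_pos.2 (sub_ne_zero.2 hx)⟩

theorem sum_max_sub_eq (hp : p ∈ stdSimplex ℝ X) (hq : q ∈ stdSimplex ℝ X) :
    ∑ x, max (p x - q x) 0 = l1Dist p q / 2 := by
  have h1 : ∑ x, (p x - q x) = 0 := by rw [Finset.sum_sub_distrib, hp.2, hq.2, sub_self]
  have h2 (x : X) : max (p x - q x) 0 = (p x - q x) / 2 + |p x - q x| / 2 := by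
    rcases le_total 0 (p x - q x) with h | h
    · rw [max_eq_left h, abs_of_nonneg h]; ring
    · rw [max_eq_right h, abs_of_nonpos h]; ring
  simp_rw [h2, Finset.sum_add_distrib, ← Finset.sum_div, h1, l1Dist]
  ring

open Classical in
/-- The outcomes to which a calibrated `q` gives at most `θ` have small `p`-mass. -/
theorem IsCalibrated.sum_ite_lt_le (h : IsCalibrated q p) (hq : q ∈ stdSimplex ℝ X)
    {θ : ℝ} (hθ : 0 ≤ θ) :
    ∑ x, (if q x < θ then p x else 0) ≤ Fintype.card X * θ := by
  have h1 := h.sum_mul_comp_eq hq (fun t => if t < θ then 1 else 0)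
  simp only [mul_ite, mul_one, mul_zero] at h1
  rw [h1, ← nsmul_eq_mul, ← Finset.card_univ]
  exact Finset.sum_le_card_nsmul _ _ _ fun x _ => by split_ifs <;> linarith

end Calibration

/-! ### Supergradients of concave functions. -/

section Concave

variable {f : ℝ → ℝ}

theorem exists_supergradient (hmono : MonotoneOn f (Ici 1)) (hconc : ConcaveOn ℝ (Ici 1) f)
    {a : ℝ} (ha : 1 < a) :
    ∃ g : ℝ, 0 ≤ g ∧ ∀ y ∈ Ici (1 : ℝ), f y ≤ f a + g * (y - a) := by
  have hint : a ∈ interior (Ici (1 : ℝ)) := by rw [interior_Ici]; exact ha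
  have hconv : ConvexOn ℝ (Ici 1) (-f) := hconc.neg
  set d := derivWithin (-f) (Ioi a) a
  have key (y : ℝ) (hy : y ∈ Ici (1 : ℝ)) : f y ≤ f a + -d * (y - a) := by
    rcases lt_trichotomy y a with h | h | h
    · have := (hconv.slope_le_leftDeriv_of_mem_interior hy hint h).trans
        (hconv.leftDeriv_le_rightDeriv_of_mem_interior hint)
      rw [slope_def_field, div_le_iff₀ (by linarith)] at this
      simp only [Pi.neg_apply] at this
      linarith
    · simp [h]
    · have := hconv.rightDeriv_le_slope_of_mem_interior hint hy h
      rw [slope_def_field, le_div_iff₀ (by linarith)] at this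
      simp only [Pi.neg_apply] at this
      linarith
  have h1 : (1 : ℝ) ≤ a + 1 := by linarith
  refine ⟨-d, ?_, key⟩
  linarith [key (a + 1) h1, hmono ha.le h1 (by linarith)]

/-- Only the midpoint of `y` and `a` is used: this gives `b / 4` instead of the optimal `b / 2`,
without differentiability. -/
theorem StrongConcaveOn.le_supergradient {s : Set ℝ} {b a g : ℝ} (hf : StrongConcaveOn s b f)
    (ha : a ∈ s) (hg : ∀ y ∈ s, f y ≤ f a + g * (y - a)) {y : ℝ} (hy : y ∈ s) :
    f y ≤ f a + g * (y - a) - b / 4 * (y - a) ^ 2 := by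
  obtain ⟨hs, hf⟩ := hf
  have half : (0 : ℝ) ≤ 1 / 2 := by norm_num
  have h1 := hf hy ha half half (by norm_num)
  have h2 := hg _ (hs hy ha half half (by norm_num))
  simp only [smul_eq_mul, Real.norm_eq_abs, sq_abs] at h1 h2
  nlinarith

end Concave

/-! ### The expected gap and its truncation. -/

section Properness

variable {f C : ℝ → ℝ}

/-- The supergradient inequality at `1 / t`, evaluated at `1 / r` and multiplied by `r`, becomes
linear in `r`. The slope is chosen before `r`, as calibration requires. Left strong concavity on
`[1, 1 / t]` only helps when `1 / r < 1 / t`. -/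
theorem mul_quadratic_le_loss_gap (hmono : MonotoneOn f (Ici 1)) (hconc : ConcaveOn ℝ (Ici 1) f)
    (hC : AntitoneOn C (Ici 1))
    (hstrong : LeftStronglyConcaveOn (Ici 1) (fun z => C z / z ^ 2) f) {t : ℝ} (ht0 : 0 < t)
    (ht1 : t < 1) :
    ∃ g : ℝ, (∀ r ∈ Icc (0 : ℝ) 1, g * (r - t) ≤ r * (f (1 / t) - f (1 / r))) ∧
      ∀ r ∈ Icc (0 : ℝ) 1, t < r → ∀ Z, 1 / t ≤ Z →
        g * (r - t) + C Z / 4 * ((r - t) ^ 2 / r) ≤ r * (f (1 / t) - f (1 / r)) := by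
  have ha : 1 < 1 / t := by rw [lt_div_iff₀ ht0]; linarith
  obtain ⟨g, hg0, hg⟩ := exists_supergradient hmono hconc ha
  refine ⟨g / t, fun r hr => ?_, fun r hr htr Z hZ => ?_⟩
  -- At `r = 0` the bound reduces to `-g ≤ 0`, which is where monotonicity of `f` enters.
  · rcases hr.1.eq_or_lt with rfl | hr0
    · have : g / t * (0 - t) = -g := by field_simp; ring
      rw [this]; simpa using hg0
    · have h1 := hg (1 / r) (by rw [mem_Ici, le_div_iff₀ hr0]; linarith [hr.2])
      have h2 := mul_le_mul_of_nonneg_left h1 hr0.le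
      have h3 : r * (g * (1 / r - 1 / t)) = -(g / t * (r - t)) := by field_simp; ring
      rw [mul_add, h3] at h2
      linarith
  · have hr0 : 0 < r := ht0.trans htr
    have hr1 : (1 : ℝ) ≤ 1 / r := by rw [le_div_iff₀ hr0]; linarith [hr.2]
    have hrt : 1 / r ≤ 1 / t := one_div_le_one_div_of_le ht0 htr.le
    have h1 := (hstrong (1 / t) ha.le).le_supergradient (a := 1 / t) (g := g)
      ⟨ha.le, le_refl (1 / t)⟩ (fun y hy => hg y hy.1) (y := 1 / r) ⟨hr1, hrt⟩
    have h2 := mul_le_mul_of_nonneg_left h1 hr0.le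
    have h3 : r * (f (1 / t) + g * (1 / r - 1 / t) -
        C (1 / t) / (1 / t) ^ 2 / 4 * (1 / r - 1 / t) ^ 2) =
        r * f (1 / t) - g / t * (r - t) - C (1 / t) / 4 * ((r - t) ^ 2 / r) := by
      field_simp; ring
    rw [h3] at h2
    have h4 : C Z ≤ C (1 / t) := hC ha.le (ha.le.trans hZ) hZ
    have h5 : 0 ≤ (r - t) ^ 2 / r := by positivity
    nlinarith

variable {X : Type*} [Fintype X] {p q : X → ℝ}

/-- Strong properness: a calibrated `q ≠ p` has a larger expected loss than `p`, with a gap that is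
quadratic in the distance. -/
theorem strong_properness (hmono : MonotoneOn f (Ici 1)) (hconc : ConcaveOn ℝ (Ici 1) f)
    (hC : AntitoneOn C (Ici 1))
    (hstrong : LeftStronglyConcaveOn (Ici 1) (fun z => C z / z ^ 2) f)
    (hp : p ∈ stdSimplex ℝ X) (hq : q ∈ stdSimplex ℝ X) (hcal : IsCalibrated q p) (hne : p ≠ q)
    (hCpos : 0 < C (4 * (Fintype.card X : ℝ) / l1Dist p q)) :
    C (4 * (Fintype.card X : ℝ) / l1Dist p q) * l1Dist p q ^ 2 / 64 ≤
      ∑ x, p x * (f (1 / q x) - f (1 / p x)) := by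
  classical
  set N : ℝ := (Fintype.card X : ℝ)
  set ε := l1Dist p q
  set K := C (4 * N / ε)
  have hε : 0 < ε := l1Dist_pos hne
  have hN : 0 < N := by
    obtain ⟨x, -⟩ := Function.ne_iff.1 hne
    exact Nat.cast_pos.2 (Fintype.card_pos_iff.2 ⟨x⟩)
  choose! g hg1 hg2 using fun (t : ℝ) (ht : 0 < t ∧ t < 1) =>
    mul_quadratic_le_loss_gap hmono hconc hC hstrong ht.1 ht.2
  -- On `s`, `1 / q x ≤ 4 * N / ε`, so the modulus of concavity is controlled by `K`.
  set s : Finset X := Finset.univ.filter fun x => q x < p x ∧ ε / (4 * N) ≤ q x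
  have hmem (x : X) : p x ∈ Icc (0 : ℝ) 1 := ⟨hp.1 x, le_one_of_mem_stdSimplex hp x⟩
  have hpt (x : X) : g (q x) * (p x - q x) +
      (if x ∈ s then K / 4 * ((p x - q x) ^ 2 / p x) else 0) ≤
        p x * (f (1 / q x) - f (1 / p x)) := by
    split_ifs with hx
    · obtain ⟨-, h1, h2⟩ := Finset.mem_filter.1 hx
      have hq0 : 0 < q x := lt_of_lt_of_le (by positivity) h2
      refine hg2 _ ⟨hq0, hcal.lt_one hp hq hne x⟩ _ (hmem x) h1 _ ?_
      rw [div_le_div_iff₀ hq0 hε]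
      rw [div_le_iff₀ (by positivity)] at h2
      linarith
    · rw [add_zero]
      rcases (hq.1 x).eq_or_lt with h0 | h0
      · simp [hcal.eq_zero hp hq h0.symm, ← h0]
      · exact hg1 _ ⟨h0, hcal.lt_one hp hq hne x⟩ _ (hmem x)
  have hsum := Finset.sum_le_sum fun x (_ : x ∈ Finset.univ) => hpt x
  have hzero : ∑ x, g (q x) * (p x - q x) = 0 := by
    have := hcal.sum_mul_comp_eq hq g
    simp_rw [mul_comm (g _), sub_mul, Finset.sum_sub_distrib, this, sub_self]
  rw [Finset.sum_add_distrib, hzero, zero_add, Finset.sum_ite_mem, Finset.univ_inter,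
    ← Finset.mul_sum] at hsum
  have hpos (x : X) (hx : x ∈ s) : 0 < p x :=
    (hq.1 x).trans_lt (Finset.mem_filter.1 hx).2.1
  -- Cauchy–Schwarz with weights `p`, of total mass at most 1.
  have hcs : (∑ x ∈ s, (p x - q x)) ^ 2 ≤ ∑ x ∈ s, (p x - q x) ^ 2 / p x := by
    have h1 := Finset.sum_sq_le_sum_mul_sum_of_sq_le_mul s
      (r := fun x => p x - q x) (f := fun x => (p x - q x) ^ 2 / p x) (g := p)
      (fun x _ => div_nonneg (sq_nonneg _) (hp.1 x)) (fun x _ => hp.1 x)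
      (fun x hx => (div_mul_cancel₀ _ (hpos x hx).ne').ge)
    refine h1.trans (mul_le_of_le_one_right
      (Finset.sum_nonneg fun x _ => div_nonneg (sq_nonneg _) (hp.1 x)) ?_)
    rw [← hp.2]
    exact Finset.sum_le_sum_of_subset_of_nonneg (Finset.subset_univ _) fun x _ _ => hp.1 x
  -- The positive part of `p - q` has mass `ε / 2`; discarding small `q x` costs at most `N * (ε /
  -- (4 * N))`.
  have hlow : ε / 4 ≤ ∑ x ∈ s, (p x - q x) := by
    have h1 : ∑ x, max (p x - q x) 0 ≤ ∑ x, (if x ∈ s then p x - q x else 0) +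
        ∑ x, (if q x < ε / (4 * N) then p x else 0) := by
      rw [← Finset.sum_add_distrib]
      refine Finset.sum_le_sum fun x _ => ?_
      simp only [s, Finset.mem_filter, Finset.mem_univ, true_and]
      have := hp.1 x
      have := hq.1 x
      rw [max_le_iff]
      constructor <;> split_ifs with h1 h2 <;> grind
    have h2 := hcal.sum_ite_lt_le hq (θ := ε / (4 * N)) (by positivity)
    have h3 : N * (ε / (4 * N)) = ε / 4 := by field_simp
    rw [sum_max_sub_eq hp hq, Finset.sum_ite_mem, Finset.univ_inter] at h1
    change _ ≤ N * _ at h2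
    change ε / 2 ≤ _ at h1
    linarith
  have h5 : (ε / 4) ^ 2 ≤ ∑ x ∈ s, (p x - q x) ^ 2 / p x :=
    (pow_le_pow_left₀ (by positivity) hlow 2).trans hcs
  nlinarith

/-- The outcomes to which `p` or a calibrated `q` gives less than `1 / β` contribute little to the
expected loss. -/
theorem sum_ite_loss_le (hmono : MonotoneOn f (Ici 1)) {c β : ℝ} (hc : 0 ≤ c)
    (hf0 : ∀ z ∈ Ici (1 : ℝ), 0 ≤ f z)
    (hf : ∀ z ∈ Ici (1 : ℝ), f z ≤ c * √z) (hβ : 1 ≤ β)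
    (hp : p ∈ stdSimplex ℝ X) (hq : q ∈ stdSimplex ℝ X) (hcal : IsCalibrated q p) :
    (∑ x, if p x < 1 / β ∨ q x < 1 / β then p x * (f (1 / q x) - f (1 / p x)) else 0) ≤
      2 * c * Fintype.card X / √β := by
  classical
  have hβ0 : 0 < β := one_pos.trans_le hβ
  have hge {r : ℝ} (h0 : 0 < r) (h1 : r ≤ 1) : 1 / r ∈ Ici (1 : ℝ) := by
    rw [mem_Ici, le_div_iff₀ h0]; linarith
  have hs : √β * √β = β := Real.mul_self_sqrt hβ0.le
  have hs0 : 0 < √β := Real.sqrt_pos.2 hβ0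
  have hs1 : 1 ≤ √β := Real.one_le_sqrt.2 hβ
  have hsmall (x : X) : (if q x < 1 / β then q x * f (1 / q x) else 0) ≤ c / √β := by
    split_ifs with h
    · rcases (hq.1 x).eq_or_lt with h0 | h0
      · rw [← h0, zero_mul]; positivity
      · have h1 := hf _ (hge h0 (le_one_of_mem_stdSimplex hq x))
        calc q x * f (1 / q x) ≤ q x * (c * √(1 / q x)) := by gcongr
          _ = c * √(q x) := by
            rw [one_div, Real.sqrt_inv]
            nth_rewrite 1 [← Real.mul_self_sqrt h0.le]
            have := (Real.sqrt_pos.2 h0).ne'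
            field_simp
          _ ≤ c * √(1 / β) := by gcongr
          _ = c / √β := by rw [one_div, Real.sqrt_inv]; rfl
    · positivity
  -- Calibration turns `p x * f (1 / q x)` into `q x * f (1 / q x)`, which `hsmall` controls.
  have hcalsum := hcal.sum_mul_comp_eq hq (fun t => if t < 1 / β then f (1 / t) else 0)
  simp only [mul_ite, mul_zero] at hcalsum
  have hpt (x : X) : (if p x < 1 / β ∨ q x < 1 / β then p x * (f (1 / q x) - f (1 / p x)) else 0)
      ≤ (if q x < 1 / β then p x * f (1 / q x) else 0) + c / √β := by
    have hp0 := hp.1 x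
    have hdrop : p x * (f (1 / q x) - f (1 / p x)) ≤ p x * f (1 / q x) := by
      rcases hp0.eq_or_lt with h0 | h0
      · simp [← h0]
      · have := mul_nonneg hp0 (hf0 _ (hge h0 (le_one_of_mem_stdSimplex hp x)))
        linarith
    have hnn : 0 ≤ c / √β := by positivity
    by_cases h1 : q x < 1 / β
    · rw [if_pos (Or.inr h1), if_pos h1]; linarith
    · by_cases h2 : p x < 1 / β
      · rw [if_pos (Or.inl h2), if_neg h1, zero_add]
        have h0 : 0 < q x := lt_of_lt_of_le (by positivity) (not_lt.1 h1)
        have hle : 1 / q x ≤ β := by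
          rw [div_le_comm₀ h0 hβ0]; exact not_lt.1 h1
        have h3 := (hmono (hge h0 (le_one_of_mem_stdSimplex hq x)) hβ hle).trans (hf β hβ)
        calc _ ≤ _ := hdrop
          _ ≤ 1 / β * (c * √β) := by
            refine mul_le_mul h2.le h3 (hf0 _ (hge h0 (le_one_of_mem_stdSimplex hq x)))
              (by positivity)
          _ = c / √β := by
            nth_rewrite 1 [← hs]; field_simp
      · rw [if_neg (by tauto), if_neg h1]; linarith
  calc _ ≤ ∑ x, ((if q x < 1 / β then p x * f (1 / q x) else 0) + c / √β) :=
        Finset.sum_le_sum fun x _ => hpt x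
    _ ≤ Fintype.card X * (c / √β) + Fintype.card X * (c / √β) := by
        have h1 := Finset.sum_le_card_nsmul Finset.univ _ _ fun x _ => hsmall x
        rw [Finset.sum_add_distrib, hcalsum, Finset.sum_const, nsmul_eq_mul]
        rw [nsmul_eq_mul] at h1
        exact add_le_add_left h1 _
    _ = _ := by ring

end Properness

/-! ### Independent samples and exponential moments. -/

section Sampling

theorem measureReal_sample_eq_sum {X : Type*} [Fintype X] [MeasurableSpace X]
    [MeasurableSingletonClass X] {p : X → ℝ} {Ω : Type*} [MeasurableSpace Ω] {P : Measure Ω}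
    [IsProbabilityMeasure P] {m : ℕ} {S : Fin m → Ω → X} (hS : ∀ i, Measurable (S i))
    (hind : iIndepFun S P) (hlaw : ∀ i x, P.real {ω | S i ω = x} = p x)
    (A : Finset (Fin m → X)) :
    P.real {ω | (fun i => S i ω) ∈ A} = ∑ s ∈ A, ∏ i, p (s i) := by
  have hmeas : Measurable fun ω i => S i ω := measurable_pi_lambda _ hS
  have h := sum_measureReal_preimage_singleton (μ := P) A (f := fun ω i => S i ω)
    (fun s _ => hmeas (measurableSet_singleton s))
  change P.real ((fun ω i => S i ω) ⁻¹' A) = _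
  rw [← h]
  refine Finset.sum_congr rfl fun s _ => ?_
  have hset : (fun ω i => S i ω) ⁻¹' {s} = ⋂ i ∈ (Finset.univ : Finset (Fin m)), S i ⁻¹' {s i} := by
    ext ω; simp [funext_iff]
  rw [hset, measureReal_def, hind.measure_inter_preimage_eq_mul Finset.univ
    (fun i _ => measurableSet_singleton (s i)), ENNReal.toReal_prod]
  exact Finset.prod_congr rfl fun i _ => hlaw i (s i)

/-- Chernoff bound for a sum restricted to samples that stay in `G`: with high probability the
sample stays in `G` and the sum is positive. -/
theorem chernoff_restricted {X : Type*} [Fintype X] {p Y : X → ℝ} (hp : ∀ x, 0 ≤ p x) (m : ℕ)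
    (G : Finset X) (l : ℝ) (hl : 0 ≤ l) (A : Finset (Fin m → X))
    (hA : ∀ s, s ∉ A → ∑ i, Y (s i) ≤ 0) :
    (∑ x ∈ G, p x) ^ m - (∑ x ∈ G, p x * Real.exp (-(l * Y x))) ^ m ≤
      ∑ s ∈ A, ∏ i, p (s i) := by
  classical
  have hpow (h : X → ℝ) : (∑ x ∈ G, h x) ^ m =
      ∑ s ∈ Fintype.piFinset fun _ : Fin m => G, ∏ i, h (s i) := by
    rw [← Finset.prod_univ_sum]; simp
  rw [hpow, hpow, ← Finset.sum_sub_distrib]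
  have hprod (s : Fin m → X) : 0 ≤ ∏ i, p (s i) := Finset.prod_nonneg fun i _ => hp _
  -- Off `A` the exponential factor is at least 1, so the left side is nonpositive.
  have hpt (s : Fin m → X) : ∏ i, p (s i) - ∏ i, p (s i) * Real.exp (-(l * Y (s i))) ≤
      if s ∈ A then ∏ i, p (s i) else 0 := by
    rw [Finset.prod_mul_distrib, ← Real.exp_sum, Finset.sum_neg_distrib, ← Finset.mul_sum]
    split_ifs with h
    · exact sub_le_self _ (mul_nonneg (hprod s) (Real.exp_pos _).le)
    · have h1 : 1 ≤ Real.exp (-(l * ∑ i, Y (s i))) :=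
        Real.one_le_exp (by nlinarith [hA s h])
      nlinarith [hprod s]
  calc _ ≤ ∑ s ∈ Fintype.piFinset fun _ : Fin m => G, if s ∈ A then ∏ i, p (s i) else 0 :=
        Finset.sum_le_sum fun s _ => hpt s
    _ ≤ ∑ s : Fin m → X, if s ∈ A then ∏ i, p (s i) else 0 :=
        Finset.sum_le_sum_of_subset_of_nonneg (Finset.subset_univ _) fun s _ _ => by
          split_ifs <;> simp [hprod s]
    _ = _ := by rw [Finset.sum_ite_mem, Finset.univ_inter]

theorem le_of_le_sum_mul {X : Type*} {p Y : X → ℝ} (G : Finset X) (hp : ∀ x ∈ G, 0 ≤ p x)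
    (hp1 : ∑ x ∈ G, p x ≤ 1) {B d : ℝ} (hd : 0 < d) (hY : ∀ x ∈ G, |Y x| ≤ B)
    (hmean : d ≤ ∑ x ∈ G, p x * Y x) : d ≤ B := by
  have hmeanB : ∑ x ∈ G, p x * Y x ≤ (∑ x ∈ G, p x) * B := by
    rw [Finset.sum_mul]
    exact Finset.sum_le_sum fun x hx =>
      mul_le_mul_of_nonneg_left ((le_abs_self _).trans (hY x hx)) (hp x hx)
  have hsum0 : 0 ≤ ∑ x ∈ G, p x := Finset.sum_nonneg hp
  have hB : 0 < B := by
    by_contra h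
    nlinarith
  nlinarith

/-- By `exp u ≤ 1 + u + u ^ 2` for `|u| ≤ 1`; the rate `d / (2 * B ^ 2)` minimizes `1 - l * d + l ^
2 * B ^ 2`. The weights may have total mass below 1, so no conditioning on `G` is needed. -/
theorem sum_mul_exp_le {X : Type*} {p Y : X → ℝ} (G : Finset X) (hp : ∀ x ∈ G, 0 ≤ p x)
    (hp1 : ∑ x ∈ G, p x ≤ 1) {B d : ℝ} (hd : 0 < d) (hY : ∀ x ∈ G, |Y x| ≤ B)
    (hmean : d ≤ ∑ x ∈ G, p x * Y x) :
    ∑ x ∈ G, p x * Real.exp (-(d / (2 * B ^ 2) * Y x)) ≤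
      (∑ x ∈ G, p x) * Real.exp (-(d ^ 2 / (4 * B ^ 2))) := by
  have hsum0 : 0 ≤ ∑ x ∈ G, p x := Finset.sum_nonneg hp
  have hdB : d ≤ B := le_of_le_sum_mul G hp hp1 hd hY hmean
  have hB : 0 < B := hd.trans_le hdB
  set l := d / (2 * B ^ 2)
  have hl : 0 < l := by positivity
  have hlB : l * B ≤ 1 := by
    have : l * B = d / (2 * B) := by simp only [l]; field_simp
    rw [this, div_le_one (by positivity)]; linarith
  have hpt (x : X) (hx : x ∈ G) : p x * Real.exp (-(l * Y x)) ≤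
      p x * (1 + l ^ 2 * B ^ 2) - l * (p x * Y x) := by
    have hu : |-(l * Y x)| ≤ l * B := by
      rw [abs_neg, abs_mul, abs_of_pos hl]; exact mul_le_mul_of_nonneg_left (hY x hx) hl.le
    have h1 := (abs_le.1 (Real.abs_exp_sub_one_sub_id_le (hu.trans hlB))).2
    have h2 : (-(l * Y x)) ^ 2 ≤ (l * B) ^ 2 := by
      rw [← sq_abs]; exact pow_le_pow_left₀ (abs_nonneg _) hu 2
    have h3 : Real.exp (-(l * Y x)) ≤ 1 + l ^ 2 * B ^ 2 - l * Y x := by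
      rw [mul_pow] at h2; linarith
    have := mul_le_mul_of_nonneg_left h3 (hp x hx)
    linarith
  have hsum := Finset.sum_le_sum hpt
  rw [Finset.sum_sub_distrib, ← Finset.sum_mul, ← Finset.mul_sum] at hsum
  have h4 : (∑ x ∈ G, p x) * d ≤ ∑ x ∈ G, p x * Y x := by nlinarith
  have h5 : 1 + l ^ 2 * B ^ 2 - l * d = 1 + -(d ^ 2 / (4 * B ^ 2)) := by
    simp only [l]; field_simp; ring
  have h6 : 1 + l ^ 2 * B ^ 2 - l * d ≤ Real.exp (-(d ^ 2 / (4 * B ^ 2))) := by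
    rw [h5]; linarith [Real.add_one_le_exp (-(d ^ 2 / (4 * B ^ 2)))]
  have h7 := mul_le_mul_of_nonneg_left h6 hsum0
  nlinarith

theorem expectedLoss_empiricalDist {X : Type*} [Fintype X] {m : ℕ} (f : ℝ → ℝ) (r : X → ℝ)
    (s : Fin m → X) :
    expectedLoss (localLoss f) r (empiricalDist s) = (∑ i, f (1 / r (s i))) / m := by
  classical
  have h : ∑ i, f (1 / r (s i)) =
      ∑ x, ((Finset.univ.filter fun i => s i = x).card : ℝ) * f (1 / r x) := by
    rw [← Finset.sum_fiberwise (g := s)]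
    refine Finset.sum_congr rfl fun x _ => ?_
    rw [← nsmul_eq_mul, ← Finset.sum_const]
    exact Finset.sum_congr rfl fun i hi => by rw [(Finset.mem_filter.1 hi).2]
  rw [h, Finset.sum_div]
  refine Finset.sum_congr rfl fun x _ => ?_
  simp only [empiricalDist, localLoss, div_mul_eq_mul_div]

end Sampling

/-! ### Numerical estimates for `β` and the failure probability. -/

section SampleProperness

/-- The two entries of the `min` serve two ends: 1 makes rare outcomes unlikely to be sampled, the
square makes their share of the mean negligible. -/
theorem le_sampleBeta {C : ℝ → ℝ} {c ε δ : ℝ} {N : ℕ} (hN : 0 < N) (hε : 0 < ε) (hc : 0 < c)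
    (hδ : δ ∈ Ioo (0 : ℝ) 1) (hC : 0 < C (4 * N / ε)) :
    288 * (N : ℝ) ^ 8 / δ ≤ sampleBeta C c N ε δ ∧
      2 * c * N / √(sampleBeta C c N ε δ) ≤ C (4 * N / ε) * ε ^ 2 / 1024 := by
  obtain ⟨hδ0, hδ1⟩ := hδ
  have hN1 : (1 : ℝ) ≤ N := Nat.one_le_cast.2 hN
  set a := C (4 * N / ε) * (ε ^ 2 / (128 * c)) with ha
  have ha0 : 0 < a := by positivity
  have hmin : 0 < min 1 (a ^ 2) := lt_min one_pos (by positivity)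
  have h1 : 288 * (N : ℝ) ^ 8 / δ ≤ sampleBeta C c N ε δ :=
    div_le_div_of_nonneg_left (by positivity) (by positivity)
      (mul_le_of_le_one_right hδ0.le (min_le_left _ _))
  have h2 : (16 * (N : ℝ) ^ 4 / a) ^ 2 ≤ sampleBeta C c N ε δ := by
    have h3 : δ * min 1 (a ^ 2) ≤ a ^ 2 :=
      (mul_le_of_le_one_left hmin.le hδ1.le).trans (min_le_right _ _)
    calc (16 * (N : ℝ) ^ 4 / a) ^ 2 = 256 * (N : ℝ) ^ 8 / a ^ 2 := by ring
      _ ≤ 288 * (N : ℝ) ^ 8 / (δ * min 1 (a ^ 2)) := by gcongr; norm_num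
  refine ⟨h1, ?_⟩
  have h3 : 16 * (N : ℝ) ^ 4 / a ≤ √(sampleBeta C c N ε δ) := Real.le_sqrt_of_sq_le h2
  calc 2 * c * N / √(sampleBeta C c N ε δ) ≤ 2 * c * N / (16 * (N : ℝ) ^ 4 / a) := by gcongr
    _ = c * a / 8 / (N : ℝ) ^ 3 := by field_simp; norm_num
    _ ≤ c * a / 8 := div_le_self (by positivity) (one_le_pow₀ hN1)
    _ = C (4 * N / ε) * ε ^ 2 / 1024 := by rw [ha]; field_simp; norm_num

theorem one_sub_le_pow_sub_pow {σ δ β e : ℝ} {m N : ℕ} (hσ0 : 0 ≤ σ) (hδ : δ ∈ Ioo (0 : ℝ) 1)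
    (hN : 0 < N) (hm : m ≤ N) (hβ : 288 * (N : ℝ) ^ 8 / δ ≤ β) (hσ : 1 - 2 * N / β ≤ σ)
    (he : 2 * Real.log (1 / δ) ≤ m * e) : 1 - δ ≤ σ ^ m - (σ * Real.exp (-e)) ^ m := by
  obtain ⟨hδ0, hδ1⟩ := hδ
  have hN1 : (1 : ℝ) ≤ N := Nat.one_le_cast.2 hN
  have hexp : Real.exp (-e) ^ m ≤ δ ^ 2 := by
    rw [← Real.exp_nat_mul, ← Real.exp_log (pow_pos hδ0 2), Real.exp_le_exp, Real.log_pow]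
    rw [one_div, Real.log_inv] at he
    push_cast
    linarith
  have hβ0 : 0 < β := lt_of_lt_of_le (by positivity) hβ
  have hsmall : m * (2 * N / β) ≤ δ / 2 := by
    have hm' : (m : ℝ) ≤ N := Nat.cast_le.2 hm
    have h8 : (N : ℝ) ^ 2 ≤ (N : ℝ) ^ 8 := pow_le_pow_right₀ hN1 (by norm_num)
    have h0 : 0 ≤ (N : ℝ) ^ 2 := by positivity
    rw [div_le_iff₀ hδ0] at hβ
    rw [← mul_div_assoc, div_le_iff₀ hβ0]
    nlinarith
  have hpow : 1 - δ / 2 ≤ σ ^ m := by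
    rcases le_total σ 1 with h1 | h1
    · have := one_add_mul_le_pow (a := σ - 1) (by linarith) m
      rw [add_sub_cancel] at this
      have h2 : (m : ℝ) * (1 - σ) ≤ m * (2 * N / β) := by gcongr; linarith
      linarith
    · linarith [one_le_pow₀ h1 (n := m)]
  have h1 : (1 - δ / 2) * (1 - δ ^ 2) ≤ σ ^ m * (1 - Real.exp (-e) ^ m) :=
    mul_le_mul hpow (by linarith) (by nlinarith) (by positivity)
  -- `(1 - δ / 2) * (1 - δ ^ 2)` exceeds `1 - δ` by `δ * (1 - δ) ^ 2 / 2`.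
  rw [mul_pow]
  nlinarith [mul_nonneg hδ0.le (sq_nonneg (1 - δ))]

end SampleProperness

theorem mainTheorem4 :
    ∃ c₁ : ℝ, 0 < c₁ ∧
      ∀ (X : Type*) [Fintype X] [MeasurableSpace X] [MeasurableSingletonClass X]
        (f C : ℝ → ℝ) (c : ℝ),
        (∀ z ∈ Ici (1 : ℝ), 0 ≤ f z) →
        MonotoneOn f (Ici 1) →
        ConcaveOn ℝ (Ici 1) f →
        (∀ z ∈ Ici (1 : ℝ), f z ≤ c * √z) →
        (∀ z ∈ Ici (1 : ℝ), 0 ≤ C z) →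
        AntitoneOn C (Ici 1) →
        LeftStronglyConcaveOn (Ici 1) (fun z => C z / z ^ 2) f →
        ∀ p ∈ stdSimplex ℝ X, ∀ q ∈ stdSimplex ℝ X,
          IsCalibrated q p → p ≠ q →
          0 < C (4 * (Fintype.card X : ℝ) / l1Dist p q) →
          ∀ δ ∈ Ioo (0 : ℝ) 1, ∀ m : ℕ, m ≤ Fintype.card X →
            c₁ * f (sampleBeta C c (Fintype.card X) (l1Dist p q) δ) ^ 2 * Real.log (1 / δ) /
                (C (4 * (Fintype.card X : ℝ) / l1Dist p q) * l1Dist p q ^ 2) ^ 2 ≤ (m : ℝ) →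
            ∀ (Ω : Type*) [MeasurableSpace Ω] (P : Measure Ω) [IsProbabilityMeasure P]
              (S : Fin m → Ω → X),
              (∀ i, Measurable (S i)) →
              iIndepFun S P →
              (∀ i x, P.real {ω | S i ω = x} = p x) →
              1 - δ ≤ P.real {ω |
                expectedLoss (localLoss f) p (empiricalDist (fun i => S i ω)) <
                  expectedLoss (localLoss f) q (empiricalDist (fun i => S i ω))} := by
  classical
  -- With `d = K * ε ^ 2 / 128`, this makes the Chernoff exponent `m * d ^ 2 / (4 * f β ^ 2)` at
  -- least `2 * log (1 / δ)`.
  refine ⟨8 * 128 ^ 2, by norm_num, ?_⟩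
  intro X _ _ _ f C c hf0 hmono hconc hfc _ hC hstrong p hp q hq hcal hne hK δ hδ m hmN hm
    Ω _ P _ S hS hind hlaw
  have hN : 0 < Fintype.card X := by
    obtain ⟨x, -⟩ := Function.ne_iff.1 hne
    exact Fintype.card_pos_iff.2 ⟨x⟩
  have hN1 : (1 : ℝ) ≤ Fintype.card X := Nat.one_le_cast.2 hN
  have hε : 0 < l1Dist p q := l1Dist_pos hne
  have hD := strong_properness hmono hconc hC hstrong hp hq hcal hne hK
  have hge {r : ℝ} (h0 : 0 < r) (h1 : r ≤ 1) : 1 / r ∈ Ici (1 : ℝ) := by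
    rw [mem_Ici, le_div_iff₀ h0]; linarith
  -- Otherwise `f` vanishes on `[1, ∞)`, contradicting the positive expected gap.
  have hc : 0 < c := by
    by_contra h
    have hz (z : ℝ) (hz1 : z ∈ Ici (1 : ℝ)) : f z = 0 := le_antisymm
      ((hfc z hz1).trans (mul_nonpos_of_nonpos_of_nonneg (not_lt.1 h) (Real.sqrt_nonneg _)))
      (hf0 z hz1)
    have hsum : ∑ x, p x * (f (1 / q x) - f (1 / p x)) = 0 := Finset.sum_eq_zero fun x _ => by
      rcases (hp.1 x).eq_or_lt with h0 | h0
      · simp [← h0]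
      · have hq0 : 0 < q x :=
          (hq.1 x).lt_of_ne fun h1 => h0.ne' (hcal.eq_zero hp hq h1.symm)
        rw [hz _ (hge h0 (le_one_of_mem_stdSimplex hp x)),
          hz _ (hge hq0 (le_one_of_mem_stdSimplex hq x)), sub_zero, mul_zero]
    rw [hsum] at hD
    exact absurd hD (not_le.2 (by positivity))
  obtain ⟨hβ, htrunc⟩ := le_sampleBeta hN hε hc hδ hK
  set N : ℝ := (Fintype.card X : ℝ)
  set ε := l1Dist p q
  set K := C (4 * N / ε)
  set β := sampleBeta C c (Fintype.card X) ε δ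
  have hβ1 : 1 ≤ β := by
    refine le_trans ?_ hβ
    rw [le_div_iff₀ hδ.1]
    linarith [one_le_pow₀ hN1 (n := 8), hδ.2]
  have hβ0 : 0 < β := one_pos.trans_le hβ1
  set Y : X → ℝ := fun x => f (1 / q x) - f (1 / p x) with hYdef
  set G : Finset X := Finset.univ.filter fun x => ¬(p x < 1 / β ∨ q x < 1 / β) with hG
  set d := K * ε ^ 2 / 128 with hd
  have hd0 : 0 < d := by positivity
  -- Truncation costs at most `K * ε ^ 2 / 1024` of the full gap `K * ε ^ 2 / 64`.
  have hmean : d ≤ ∑ x ∈ G, p x * Y x := by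
    have h1 := Finset.sum_filter_add_sum_filter_not Finset.univ
      (fun x => p x < 1 / β ∨ q x < 1 / β) (fun x => p x * Y x)
    have h2 := (sum_ite_loss_le hmono hc.le hf0 hfc hβ1 hp hq hcal).trans htrunc
    rw [← Finset.sum_filter] at h2
    have h3 : 0 < K * ε ^ 2 := by positivity
    linarith
  have hY (x : X) (hx : x ∈ G) : |Y x| ≤ f β := by
    have hx' := (Finset.mem_filter.1 hx).2
    rw [not_or, not_lt, not_lt] at hx'
    have hb {r : ℝ} (h : 1 / β ≤ r) (h1 : r ≤ 1) : 0 ≤ f (1 / r) ∧ f (1 / r) ≤ f β := by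
      have h0 : 0 < r := lt_of_lt_of_le (by positivity) h
      exact ⟨hf0 _ (hge h0 h1), hmono (hge h0 h1) hβ1 ((div_le_comm₀ h0 hβ0).2 h)⟩
    have h1 := hb hx'.1 (le_one_of_mem_stdSimplex hp x)
    have h2 := hb hx'.2 (le_one_of_mem_stdSimplex hq x)
    rw [abs_le]
    constructor <;> simp only [hYdef] <;> linarith
  have hσ0 : 0 ≤ ∑ x ∈ G, p x := Finset.sum_nonneg fun x _ => hp.1 x
  have hσ1 : ∑ x ∈ G, p x ≤ 1 := by
    rw [← hp.2]
    exact Finset.sum_le_sum_of_subset_of_nonneg (Finset.subset_univ _) fun x _ _ => hp.1 x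
  have hσ : 1 - 2 * N / β ≤ ∑ x ∈ G, p x := by
    have h1 := hcal.sum_ite_lt_le hq (θ := 1 / β) (by positivity)
    have h2 : ∑ x, p x ≤ ∑ x, ((if x ∈ G then p x else 0) +
        ((if q x < 1 / β then p x else 0) + 1 / β)) := by
      refine Finset.sum_le_sum fun x _ => ?_
      have h0 := hp.1 x
      have hb : 0 < 1 / β := by positivity
      simp only [hG, Finset.mem_filter, Finset.mem_univ, true_and, not_or, not_lt]
      split_ifs <;> grind
    rw [Finset.sum_add_distrib, Finset.sum_add_distrib, Finset.sum_ite_mem, Finset.univ_inter,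
      hp.2, Finset.sum_const, nsmul_eq_mul, Finset.card_univ] at h2
    change _ ≤ N * _ at h1
    change _ ≤ _ + (_ + N * _) at h2
    have h3 : 2 * N / β = N * (1 / β) + N * (1 / β) := by ring
    linarith
  have hB : 0 < f β := hd0.trans_le (le_of_le_sum_mul G (fun x _ => hp.1 x) hσ1 hd0 hY hmean)
  have hL : 0 < Real.log (1 / δ) := Real.log_pos (by rw [lt_div_iff₀ hδ.1]; linarith [hδ.2])
  have hm0 : (0 : ℝ) < m := lt_of_lt_of_le (by positivity) hm
  have he : 2 * Real.log (1 / δ) ≤ m * (d ^ 2 / (4 * f β ^ 2)) := by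
    have h1 : 2 * Real.log (1 / δ) = 8 * 128 ^ 2 * f β ^ 2 * Real.log (1 / δ) / (K * ε ^ 2) ^ 2 *
        (d ^ 2 / (4 * f β ^ 2)) := by rw [hd]; field_simp; norm_num
    rw [h1]
    exact mul_le_mul_of_nonneg_right hm (by positivity)
  set A : Finset (Fin m → X) := Finset.univ.filter fun s => 0 < ∑ i, Y (s i)
  have hevent : {ω | expectedLoss (localLoss f) p (empiricalDist (fun i => S i ω)) <
      expectedLoss (localLoss f) q (empiricalDist (fun i => S i ω))} =
      {ω | (fun i => S i ω) ∈ A} := by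
    ext ω
    simp only [A, mem_ofPred_eq, Finset.mem_filter, Finset.mem_univ, true_and,
      expectedLoss_empiricalDist, div_lt_div_iff_of_pos_right hm0, hYdef, Finset.sum_sub_distrib,
      sub_pos]
  rw [hevent, measureReal_sample_eq_sum hS hind hlaw]
  refine le_trans ?_ (chernoff_restricted hp.1 m G (d / (2 * f β ^ 2)) (by positivity) A
    fun s hs => by simpa [A] using hs)
  refine (one_sub_le_pow_sub_pow hσ0 hδ hN hmN hβ hσ he).trans (sub_le_sub_left ?_ _)
  exact pow_le_pow_left₀ (Finset.sum_nonneg fun x _ => mul_nonneg (hp.1 x) (Real.exp_pos _).le)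
    (sum_mul_exp_le G (fun x _ => hp.1 x) hσ1 hd0 hY hmean) m
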